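/- Let $n\ge 2$ and let $\langle x,y\rangle=x_1y_1+\dots+x_ny_n-x_{n+1}y_{n+1}$ on $\mathbb{R}^{n+1}$, $|v|=\sqrt{|\langle v,v\rangle|}$. Let $\mathbb{H}^n=\{x:\langle x,x\rangle=-1,\ x_{n+1}>0\}$ be the hyperbolic space with the induced Riemannian metric; $\nabla u$, $u_i$, $u_{ij}$ denote the gradient and the first and second covariant derivatives of a function $u$ in a local orthonormal frame. Closures and boundaries are taken in $\mathbb{H}^n$, and $\mathcal{C}_{\overline\Omega}=\{\rho q: q\in\overline\Omega,\ \rho>0\}$. As usual, $C^k(\overline\Omega)$ (resp. $C^k(\mathcal{C}_{\overline\Omega})$) consists of the functions of class $C^k$ in $\Omega$ (resp. in the cone over $\Omega$) that extend continuously, together with their derivatives up to order $k$, to $\overline\Omega$ (resp. $\mathcal{C}_{\overline\Omega}$). Let $\Omega$ be a bounded domain of $\mathbb{H}^n$ satisfying a uniform exterior geodesic ball condition: there exist $\sigma>0$ and a map $\Xi:\partial\Omega\to\mathbb{H}^n$ of class $C^2$ such that for every $q_0\in\partial\Omega$ the open geodesic ball $B_\sigma(\xi)$ of radius $\sigma$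 centred at $\xi=\Xi(q_0)\in\mathbb{H}^n\setminus\overline\Omega$ satisfies $q_0\in\partial B_\sigma(\xi)$ and $B_\sigma(\xi)\subset\mathbb{H}^n\setminus\overline\Omega$. Let $H\in C^1(\mathcal{C}_{\overline\Omega})$ be such that $H>0$ and $$\frac{\partial}{\partial\lambda}\bigl(\lambda H(\lambda q)\bigr)\le 0\qquad\text{for all } q\in\overline\Omega,\ \lambda>0.$$ Then $(\Omega,H)$ is admissible, that is: there exists a constant $\theta\in(0,1)$ such that for every $q_0\in\partial\Omega$ and every $t\in[0,1]$ there exist $\varphi_1,\varphi_2\in C^2(\overline\Omega)$ with (i) $\sup_\Omega|\nabla\varphi_i|\le 1-\theta$ for $i=1,2$; (ii) $\varphi_1(q_0)=0$ and $\varphi_1\le 0$ on $\partial\Omega$; (iii) $\varphi_2(q_0)=0$ and $\varphi_2\ge 0$ on $\partial\Omega$; (iv) $\mathcal{Q}^t(\varphi_1)\ge 0$ and $\mathcal{Q}^t(\varphi_2)\le 0$ in $\Omega$, where $$\mathcal{Q}^t(u)=\sum_{i,j=1}^n\bigl((1-|\nabla u|^2)\delta_{ij}+u_iu_j\bigr)u_{ij}-nt(1-|\nabla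 u|^2)+nt(1-|\nabla u|^2)^{3/2}e^{u}H(e^{u}q).$$ -/

import Mathlib

noncomputable section

namespace LorentzMinkowski

/-- The vector space underlying the Lorentz-Minkowski space of dimension `n + 1`;
the last coordinate is the time coordinate. -/
abbrev L (n : ℕ) : Type := EuclideanSpace ℝ (Fin (n + 1))

/-- The Lorentz form `x₁ y₁ + ⋯ + xₙ yₙ - xₙ₊₁ yₙ₊₁`. -/
def form {n : ℕ} (x y : L n) : ℝ :=
  (∑ i : Fin n, x i.castSucc * y i.castSucc) - x (Fin.last n) * y (Fin.last n)

/-- The modulus `|v| = √|⟨v, v⟩|`. -/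
def modulus {n : ℕ} (v : L n) : ℝ := √|form v v|

/-- The hyperbolic space as the upper sheet of the hyperboloid (a closed subset of `L n`). -/
def hyp (n : ℕ) : Set (L n) := {x | form x x = -1 ∧ 0 < x (Fin.last n)}

/-- The geodesic distance of the hyperboloid model, `cosh d(p, q) = -⟨p, q⟩`. -/
def hdist {n : ℕ} (p q : L n) : ℝ := Real.arcosh (-form p q)

/-- The open geodesic ball of radius `r` centred at `c`. -/
def hball {n : ℕ} (c : L n) (r : ℝ) : Set (L n) := {p | p ∈ hyp n ∧ hdist p c < r}

/-- The boundary of `A ⊆ hyp n` relative to the hyperbolic space. As `hyp n` is closed in `L n`,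
closures in the hyperbolic space and in `L n` agree. -/
def hfrontier {n : ℕ} (A : Set (L n)) : Set (L n) := closure A ∩ closure (hyp n \ A)

/-- Bounded domains of the hyperbolic space: relatively open, connected, nonempty, and bounded
for the geodesic distance. -/
structure IsBoundedDomain {n : ℕ} (Ω : Set (L n)) : Prop where
  subset : Ω ⊆ hyp n
  isOpen : ∃ U : Set (L n), IsOpen U ∧ Ω = hyp n ∩ U
  isConnected : IsConnected Ω
  bounded : ∃ R : ℝ, ∀ p ∈ Ω, ∀ q ∈ Ω, hdist p q ≤ R

/-- The cone `{ρ q : q ∈ A, ρ > 0}` spanned by `A`. -/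
def cone {n : ℕ} (A : Set (L n)) : Set (L n) := {x | ∃ q ∈ A, ∃ ρ : ℝ, 0 < ρ ∧ x = ρ • q}

/-- `f ∈ C^k` on the cone over the closure of a relatively open `Ω ⊆ hyp n`: `f` is of class `C^k`
on the (open) cone over `Ω`, and `f` and its derivatives up to order `k` extend continuously to
the cone over the closure, the values of `f` there being those of the extension. -/
def IsCkCone {n : ℕ} (k : ℕ) (Ω : Set (L n)) (f : L n → ℝ) : Prop :=
  ContDiffOn ℝ k f (cone Ω) ∧ ContinuousOn f (cone (closure Ω)) ∧
    ∀ m : ℕ, m ≤ k → ∃ G : L n → ContinuousMultilinearMap ℝ (fun _ : Fin m => L n) ℝ,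
      ContinuousOn G (cone (closure Ω)) ∧ Set.EqOn G (iteratedFDeriv ℝ m f) (cone Ω)

/-- The extension of a function on (a part of) the hyperbolic space that is constant along rays. -/
def radialExt {n : ℕ} (u : L n → ℝ) (x : L n) : ℝ := u ((modulus x)⁻¹ • x)

/-- `u ∈ C^k(Ω̄)` for `Ω` relatively open in the hyperbolic space: `u` is `C^k` in `Ω` and its
derivatives up to order `k` extend continuously to the closure. Since `(ρ, q) ↦ ρ q` is a
diffeomorphism onto the open cone, this is expressed by the extension constant along rays. -/
def IsCkClosure {n : ℕ} (k : ℕ) (Ω : Set (L n)) (u : L n → ℝ) : Prop :=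
  IsCkCone k Ω (radialExt u)

/-- A map of class `C^k` on an arbitrary set `S`: near each point of `S` it is the restriction
of a `C^k` map defined on an open set. -/
def IsCkOnSet {n : ℕ} (k : ℕ) (S : Set (L n)) (f : L n → L n) : Prop :=
  ∀ x ∈ S, ∃ U : Set (L n), IsOpen U ∧ x ∈ U ∧
    ∃ g : L n → L n, ContDiffOn ℝ k g U ∧ Set.EqOn f g (S ∩ U)

/-- The `j`-th vector of the standard basis. -/
def stdVec {n : ℕ} (j : Fin (n + 1)) : L n := EuclideanSpace.single j 1

/-- The gradient of `f` for the Lorentz form, i.e. `⟨lgrad f x, v⟩ = df(x) v` for all `v`. -/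
def lgrad {n : ℕ} (f : L n → ℝ) (x : L n) : L n :=
  (∑ i : Fin n, fderiv ℝ f x (stdVec i.castSucc) • stdVec i.castSucc)
    - fderiv ℝ f x (stdVec (Fin.last n)) • stdVec (Fin.last n)

/-- The gradient of `u` on the hyperbolic space. At `q ∈ hyp n` the differential of `radialExt u`
is `du` on tangent vectors and vanishes on the normal direction `q`, so `grad u q` is the tangent
vector that represents `du` for the induced metric. -/
def grad {n : ℕ} (u : L n → ℝ) : L n → L n := lgrad (radialExt u)

/-- The projection of `L n` onto the tangent space `q^⊥` of the hyperbolic space at `q`. -/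
def tangProj {n : ℕ} (q w : L n) : L n := w + form w q • q

/-- The Levi-Civita connection of the hyperbolic space: the tangential part of the flat
derivative of the vector field `X` in the tangent direction `v`. -/
def covDeriv {n : ℕ} (X : L n → L n) (q v : L n) : L n := tangProj q (fderiv ℝ X q v)

/-- The Hessian `∇²u(v, w) = ⟨∇_v ∇u, w⟩` for tangent vectors `v`, `w` at `q`. -/
def hess {n : ℕ} (u : L n → ℝ) (q v w : L n) : ℝ := form (covDeriv (grad u) q v) w

/-- `e` is an orthonormal basis of the tangent space of the hyperbolic space at `q`. -/
def IsOrthonormalFrame {n : ℕ} (q : L n) (e : Fin n → L n) : Prop :=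
  (∀ i, form (e i) q = 0) ∧ ∀ i j, form (e i) (e j) = if i = j then 1 else 0

/-- The value at `q` of the operator
`∑ᵢⱼ ((1 - |∇u|²) δᵢⱼ + uᵢ uⱼ) uᵢⱼ - n t (1 - |∇u|²) + n t (1 - |∇u|²)^{3/2} e^u H(e^u q)`,
with covariant derivatives `uᵢ`, `uᵢⱼ` taken in the orthonormal frame `e` at `q`; it does not
depend on the frame. -/
def Qop {n : ℕ} (H : L n → ℝ) (t : ℝ) (u : L n → ℝ) (q : L n) (e : Fin n → L n) : ℝ :=
  (∑ i : Fin n, ∑ j : Fin n,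
      ((1 - modulus (grad u q) ^ 2) * (if i = j then 1 else 0)
        + form (grad u q) (e i) * form (grad u q) (e j)) * hess u q (e i) (e j))
    - n * t * (1 - modulus (grad u q) ^ 2)
    + n * t * (1 - modulus (grad u q) ^ 2) ^ (3 / 2 : ℝ)
        * (Real.exp (u q) * H (Real.exp (u q) • q))

/-- `(Ω, H, θ)` is admissible. -/
def IsAdmissibleWith {n : ℕ} (Ω : Set (L n)) (H : L n → ℝ) (θ : ℝ) : Prop :=
  ∀ q₀ ∈ hfrontier Ω, ∀ t ∈ Set.Icc (0 : ℝ) 1, ∃ φ₁ φ₂ : L n → ℝ,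
    IsCkClosure 2 Ω φ₁ ∧ IsCkClosure 2 Ω φ₂ ∧
    (∀ q ∈ Ω, modulus (grad φ₁ q) ≤ 1 - θ) ∧ (∀ q ∈ Ω, modulus (grad φ₂ q) ≤ 1 - θ) ∧
    (φ₁ q₀ = 0 ∧ ∀ q ∈ hfrontier Ω, φ₁ q ≤ 0) ∧
    (φ₂ q₀ = 0 ∧ ∀ q ∈ hfrontier Ω, 0 ≤ φ₂ q) ∧
    (∀ q ∈ Ω, ∀ e, IsOrthonormalFrame q e → 0 ≤ Qop H t φ₁ q e) ∧
    (∀ q ∈ Ω, ∀ e, IsOrthonormalFrame q e → Qop H t φ₂ q e ≤ 0)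

/-- `(Ω, H)` is admissible. -/
def IsAdmissible {n : ℕ} (Ω : Set (L n)) (H : L n → ℝ) : Prop :=
  ∃ θ ∈ Set.Ioo (0 : ℝ) 1, IsAdmissibleWith Ω H θ

/-- The uniform exterior geodesic ball condition. -/
def UniformExteriorBall {n : ℕ} (Ω : Set (L n)) : Prop :=
  ∃ σ : ℝ, 0 < σ ∧ ∃ Ξ : L n → L n, IsCkOnSet 2 (hfrontier Ω) Ξ ∧
    ∀ q₀ ∈ hfrontier Ω, Ξ q₀ ∈ hyp n \ closure Ω ∧ q₀ ∈ hfrontier (hball (Ξ q₀) σ) ∧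
      hball (Ξ q₀) σ ⊆ hyp n \ closure Ω

end LorentzMinkowski

end

noncomputable section

namespace LorentzMinkowski

variable {n : ℕ}

/-! ### Algebra of the Lorentz form -/

/-! The barriers at `q₀` are radial about the centre `c = Ξ q₀` of the exterior ball. With `r` the
distance to `c`, take `φ₁ = f(r)`, where `f(σ) = 0` and `f' = -tanh (C (R - r))`, and `φ₂ = -φ₁`. On
`closure Ω` one has `σ ≤ r ≤ R`, so `f ≤ 0` and `|∇φᵢ| = |f'| ≤ tanh (C (R - σ)) = 1 - θ`.

For a radial function put `P = 1 - f'²`; the second-order part of the operator is `f'' + (n - 1) P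
f' coth r` (`Qop_comp_neg_form`). The profile solves `f'' = C (1 - f'²) = C P`, so this part is `P`
times a bracket that is at least `C - (n - 1) coth σ = n M`. The terms of order zero also scale with
`P`. For `φ₁`, `n M P` absorbs `n t P`, and the term with `H` is positive. For `φ₂`, the
second-order part is at most `-n M P`; since `φ₂ ≥ 0`, monotonicity along rays gives `e^u H(e^u q) ≤
H(q) ≤ M` (`exp_mul_le_of_deriv_nonpos`), and `P^(3/2) ≤ P`.

The constants do not depend on `q₀` or `t`: `M` and `R` come from compactness
(`IsBoundedDomain.exists_le_of_isCkCone`, `IsBoundedDomain.exists_hdist_le`). Calculations use the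
variable `s = cosh r = -⟨q, c⟩`, which is linear in the ambient space. -/

lemma form_comm (x y : L n) : form x y = form y x := by
  simp [form, mul_comm]

lemma form_add_left (x y z : L n) : form (x + y) z = form x z + form y z := by
  simp only [form, PiLp.add_apply, add_mul, Finset.sum_add_distrib]; ring

lemma form_smul_left (c : ℝ) (x y : L n) : form (c • x) y = c * form x y := by
  simp only [form, PiLp.smul_apply, smul_eq_mul, mul_sub, Finset.mul_sum, mul_assoc]

lemma form_add_right (x y z : L n) : form x (y + z) = form x y + form x z := by
  rw [form_comm, form_add_left, form_comm y, form_comm z]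

lemma form_smul_right (c : ℝ) (x y : L n) : form x (c • y) = c * form x y := by
  rw [form_comm, form_smul_left, form_comm y]

lemma form_neg_left (x y : L n) : form (-x) y = -form x y := by
  rw [← neg_one_smul ℝ, form_smul_left]; ring

@[simp] lemma form_zero_left (y : L n) : form 0 y = 0 := by
  simp [form]

lemma form_sum_left {ι : Type*} (s : Finset ι) (f : ι → L n) (z : L n) :
    form (∑ i ∈ s, f i) z = ∑ i ∈ s, form (f i) z := by
  classical
  induction s using Finset.induction_on with
  | empty => simp [form]
  | insert a s ha ih => rw [Finset.sum_insert ha, Finset.sum_insert ha, form_add_left, ih]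

/-- The continuous linear functional `v ↦ ⟨y, v⟩`. -/
def formCLM (y : L n) : L n →L[ℝ] ℝ :=
  LinearMap.toContinuousLinearMap
    { toFun := form y
      map_add' := form_add_right y
      map_smul' := fun c x => form_smul_right c y x }

@[simp] lemma formCLM_apply (y v : L n) : formCLM y v = form y v := rfl

lemma form_stdVec_castSucc (y : L n) (i : Fin n) : form y (stdVec i.castSucc) = y i.castSucc := by
  simp [form, stdVec, (Fin.castSucc_ne_last _).symm]

lemma form_stdVec_last (y : L n) : form y (stdVec (Fin.last n)) = -y (Fin.last n) := by
  simp [form, stdVec, Fin.castSucc_ne_last]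

lemma lgrad_eq {f : L n → ℝ} {x A : L n} (h : HasFDerivAt f (formCLM A) x) : lgrad f x = A := by
  ext j
  rw [lgrad, h.fderiv]
  simp only [formCLM_apply, form_stdVec_castSucc, form_stdVec_last]
  refine Fin.lastCases ?_ (fun i => ?_) j
  · simp [stdVec, (Fin.castSucc_ne_last _).symm]
  · simp [stdVec, Fin.castSucc_ne_last, Pi.single_apply, Fin.castSucc_inj]

lemma hasFDerivAt_form_left (y x : L n) : HasFDerivAt (fun x => form x y) (formCLM y) x := by
  have h := (formCLM y).hasFDerivAt (x := x)
  exact h.congr_of_eventuallyEq (.of_forall fun z => form_comm z y)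

lemma contDiff_form {k : WithTop ℕ∞} : ContDiff ℝ k fun p : L n × L n => form p.1 p.2 := by
  unfold form; fun_prop

lemma continuous_form : Continuous fun p : L n × L n => form p.1 p.2 :=
  (contDiff_form (k := 0)).continuous

lemma hasFDerivAt_form_self (x : L n) :
    HasFDerivAt (fun x : L n => form x x) ((2 : ℝ) • formCLM x) x := by
  have hd : DifferentiableAt ℝ (fun x : L n => form x x) x := by
    unfold form; fun_prop
  convert hd.hasFDerivAt using 1
  ext v
  -- The differential is identified on each line `τ ↦ x + τ v`, where the form is a quadratic
  -- polynomial in `τ`.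
  have h1 := hd.hasFDerivAt.comp_hasDerivAt_of_eq (0 : ℝ)
    (((hasDerivAt_id (0 : ℝ)).smul_const v).const_add x) (by simp)
  have h2 : HasDerivAt (fun τ : ℝ => form x x + 2 * τ * form x v + τ ^ 2 * form v v)
      (2 * form x v) 0 := by
    have := (((hasDerivAt_id (0 : ℝ)).const_mul 2).mul_const (form x v)).const_add (form x x)
      |>.add ((hasDerivAt_pow 2 (0 : ℝ)).mul_const (form v v))
    exact this.congr_deriv (by simp)
  have h3 := h1.unique (h2.congr_of_eventuallyEq (.of_forall fun τ => ?_))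
  · simpa using h3.symm
  · simp [form_add_left, form_add_right, form_smul_left, form_smul_right, form_comm v x]; ring

/-! ### The hyperboloid -/

lemma modulus_of_mem_hyp {x : L n} (hx : x ∈ hyp n) : modulus x = 1 := by
  simp [modulus, hx.1]

lemma isClosed_hyp : IsClosed (hyp n) := by
  have : hyp n = {x | form x x = -1} ∩ {x : L n | 0 ≤ x (Fin.last n)} := by
    ext x
    refine ⟨fun h => ⟨h.1, h.2.le⟩, fun h => ⟨h.1, lt_of_le_of_ne h.2 fun h0 => ?_⟩⟩
    have h1 : form x x = -1 := h.1
    simp only [form, ← h0, mul_zero, sub_zero] at h1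
    linarith [Finset.sum_nonneg fun (i : Fin n) (_ : i ∈ Finset.univ) =>
      mul_self_nonneg (x i.castSucc)]
  rw [this]
  refine .inter (isClosed_eq ?_ continuous_const) (isClosed_le continuous_const (by fun_prop))
  exact continuous_form.comp (continuous_id.prodMk continuous_id)

lemma sum_sq_of_mem_hyp {x : L n} (hx : x ∈ hyp n) :
    ∑ i : Fin n, x i.castSucc ^ 2 = x (Fin.last n) ^ 2 - 1 := by
  have := hx.1
  simp only [form, ← pow_two] at this
  linarith

lemma sum_mul_sq_le {p q : L n} (hp : p ∈ hyp n) (hq : q ∈ hyp n) :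
    (∑ i : Fin n, p i.castSucc * q i.castSucc) ^ 2
      ≤ (p (Fin.last n) ^ 2 - 1) * (q (Fin.last n) ^ 2 - 1) := by
  rw [← sum_sq_of_mem_hyp hp, ← sum_sq_of_mem_hyp hq]
  exact Finset.sum_mul_sq_le_sq_mul_sq _ _ _

lemma one_le_last {p : L n} (hp : p ∈ hyp n) : 1 ≤ p (Fin.last n) := by
  have h := sum_sq_of_mem_hyp hp
  have h0 := Finset.sum_nonneg fun (i : Fin n) (_ : i ∈ Finset.univ) => sq_nonneg (p i.castSucc)
  nlinarith [hp.2]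

/-- The reversed Cauchy-Schwarz inequality. -/
lemma one_le_neg_form {p q : L n} (hp : p ∈ hyp n) (hq : q ∈ hyp n) : 1 ≤ -form p q := by
  have h := sum_mul_sq_le hp hq
  have hp1 := one_le_last hp
  have hq1 := one_le_last hq
  simp only [form]
  set a := p (Fin.last n)
  set b := q (Fin.last n)
  set S := ∑ i : Fin n, p i.castSucc * q i.castSucc
  have hab : 1 ≤ a * b := by nlinarith
  have : S ≤ a * b - 1 := abs_le_of_sq_le_sq' (by nlinarith [sq_nonneg (a - b)]) (by linarith) |>.2
  linarith

lemma neg_form_eq_cosh {p q : L n} (hp : p ∈ hyp n) (hq : q ∈ hyp n) :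
    -form p q = Real.cosh (hdist p q) := (Real.cosh_arcosh (one_le_neg_form hp hq)).symm

lemma hdist_nonneg {p q : L n} (hp : p ∈ hyp n) (hq : q ∈ hyp n) : 0 ≤ hdist p q :=
  Real.arcosh_nonneg (one_le_neg_form hp hq)

lemma continuousOn_hdist :
    ContinuousOn (fun p : L n × L n => hdist p.1 p.2) (hyp n ×ˢ hyp n) :=
  Real.continuousOn_arcosh.comp continuous_form.neg.continuousOn
    fun _ hp => one_le_neg_form hp.1 hp.2

lemma last_le_of_neg_form_le {p q : L n} (hp : p ∈ hyp n) (hq : q ∈ hyp n) {C : ℝ}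
    (h : -form p q ≤ C) : q (Fin.last n) ≤ 2 * p (Fin.last n) * C := by
  have hS := sum_mul_sq_le hp hq
  have hp1 := one_le_last hp
  have hq1 := one_le_last hq
  simp only [form] at h
  set a := p (Fin.last n)
  set b := q (Fin.last n)
  set S := ∑ i : Fin n, p i.castSucc * q i.castSucc
  -- Cauchy-Schwarz gives `S ≤ √(a² - 1) b`, and `√(a² - 1) ≤ a - 1 / (2a)`; the gain `b / (2a)`
  -- over `a b` is what bounds `b`.
  have h1 : S ≤ (a - 1 / (2 * a)) * b := by
    refine abs_le_of_sq_le_sq' ?_ ?_ |>.2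
    · have : (a - 1 / (2 * a)) ^ 2 = a ^ 2 - 1 + (1 / (2 * a)) ^ 2 := by
        field_simp; ring
      rw [mul_pow, this]
      nlinarith [sq_nonneg (1 / (2 * a)), sq_nonneg b, mul_nonneg (sq_nonneg (1 / (2 * a)))
        (sq_nonneg b), sq_nonneg a]
    · have : 1 / (2 * a) ≤ a := by rw [div_le_iff₀ (by linarith)]; nlinarith
      exact mul_nonneg (by linarith) (by linarith)
  have h2 : b / (2 * a) ≤ C := by
    have : (a - 1 / (2 * a)) * b = a * b - b / (2 * a) := by ring
    linarith
  rw [div_le_iff₀ (by linarith)] at h2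
  linarith

lemma norm_le_of_mem_hyp {q : L n} (hq : q ∈ hyp n) : ‖q‖ ≤ 2 * q (Fin.last n) := by
  have h1 := one_le_last hq
  refine abs_le_of_sq_le_sq' ?_ (by linarith) |>.2
  rw [EuclideanSpace.real_norm_sq_eq, Fin.sum_univ_castSucc, sum_sq_of_mem_hyp hq]
  nlinarith

lemma IsBoundedDomain.closure_subset {Ω : Set (L n)} (hΩ : IsBoundedDomain Ω) :
    closure Ω ⊆ hyp n := closure_minimal hΩ.subset isClosed_hyp

lemma IsBoundedDomain.isCompact_closure {Ω : Set (L n)} (hΩ : IsBoundedDomain Ω) :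
    IsCompact (closure Ω) := by
  refine Bornology.IsBounded.isCompact_closure ?_
  obtain ⟨R, hR⟩ := hΩ.bounded
  obtain ⟨p, hp⟩ := hΩ.isConnected.nonempty
  refine isBounded_iff_forall_norm_le.2 ⟨2 * (2 * p (Fin.last n) * Real.cosh R), fun q hq => ?_⟩
  refine (norm_le_of_mem_hyp (hΩ.subset hq)).trans ?_
  have := last_le_of_neg_form_le (hΩ.subset hp) (hΩ.subset hq) (C := Real.cosh R) ?_
  · linarith
  · rw [neg_form_eq_cosh (hΩ.subset hp) (hΩ.subset hq), Real.cosh_le_cosh,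
      abs_of_nonneg (hdist_nonneg (hΩ.subset hp) (hΩ.subset hq))]
    exact (hR p hp q hq).trans (le_abs_self R)

lemma hdist_eq_of_mem_hfrontier_hball {c p : L n} {r : ℝ} (hc : c ∈ hyp n)
    (hp : p ∈ hfrontier (hball c r)) : hdist p c = r := by
  have hcont : ContinuousOn (fun p => hdist p c) (hyp n) :=
    ContinuousOn.comp (g := fun p : L n × L n => hdist p.1 p.2) (f := fun p : L n => (p, c))
      continuousOn_hdist (by fun_prop) fun q hq => Set.mk_mem_prod hq hc
  have hle : closure (hball c r) ⊆ hyp n ∩ (fun p => hdist p c) ⁻¹' Set.Iic r :=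
    closure_minimal (fun q hq => ⟨hq.1, hq.2.le⟩)
      (hcont.preimage_isClosed_of_isClosed isClosed_hyp isClosed_Iic)
  have hge : closure (hyp n \ hball c r) ⊆ hyp n ∩ (fun p => hdist p c) ⁻¹' Set.Ici r :=
    closure_minimal (fun q hq => ⟨hq.1, not_lt.1 fun h => hq.2 ⟨hq.1, h⟩⟩)
      (hcont.preimage_isClosed_of_isClosed isClosed_hyp isClosed_Ici)
  exact le_antisymm (hle hp.1).2 (hge hp.2).2

/-- Parseval: the frame together with `q` is a Lorentz-orthogonal basis of the ambient space, and a
tangent vector has no component along `q`. -/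
lemma IsOrthonormalFrame.sum_form_sq {q : L n} (hq : form q q = -1) {e : Fin n → L n}
    (he : IsOrthonormalFrame q e) {X : L n} (hX : form X q = 0) :
    ∑ i, form X (e i) ^ 2 = form X X := by
  have hqe : ∀ i, form q (e i) = 0 := fun i => by rw [form_comm, he.1]
  let b : Fin (n + 1) → L n := Fin.snoc e q
  have hli : LinearIndependent ℝ b := by
    refine Fintype.linearIndependent_iff.2 fun g hg => ?_
    rw [Fin.sum_univ_castSucc] at hg
    simp only [b, Fin.snoc_castSucc, Fin.snoc_last] at hg
    refine Fin.lastCases ?_ fun i => ?_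
    · have := congrArg (form · q) hg
      simpa [form_add_left, form_sum_left, form_smul_left, he.1, hq] using this
    · have := congrArg (form · (e i)) hg
      simpa [form_add_left, form_sum_left, form_smul_left, he.2, hqe] using this
  have hspan : X ∈ Submodule.span ℝ (Set.range b) := by
    rw [hli.span_eq_top_of_card_eq_finrank (by simp)]; trivial
  obtain ⟨c, hc⟩ := (Submodule.mem_span_range_iff_exists_fun ℝ).1 hspan
  rw [Fin.sum_univ_castSucc] at hc
  simp only [b, Fin.snoc_castSucc, Fin.snoc_last] at hc
  have hlast : c (Fin.last n) = 0 := by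
    have := congrArg (form · q) hc
    simpa [form_add_left, form_sum_left, form_smul_left, he.1, hq, hX] using this
  rw [hlast, zero_smul, add_zero] at hc
  have hci : ∀ i, c i.castSucc = form X (e i) := fun i => by
    rw [← hc]; simp [form_sum_left, form_smul_left, he.2]
  have : form X X = form (∑ i, c i.castSucc • e i) X := by rw [hc]
  rw [this, form_sum_left]
  refine Finset.sum_congr rfl fun i _ => ?_
  rw [form_smul_left, hci, form_comm (e i)]; ring

/-! ### Functions of the distance to a point -/

/-- The hyperbolic cosine of the distance from the radial projection of `x` to `c`. -/
def coshDist (c x : L n) : ℝ := -form x c * (modulus x)⁻¹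

lemma coshDist_of_mem_hyp {x : L n} (hx : x ∈ hyp n) (c : L n) : coshDist c x = -form x c := by
  simp [coshDist, modulus_of_mem_hyp hx]

lemma radialExt_comp_neg_form (F : ℝ → ℝ) (c : L n) :
    radialExt (fun q => F (-form q c)) = fun x => F (coshDist c x) := by
  ext x
  simp only [radialExt, coshDist, form_smul_left]
  congr 1; ring

lemma modulus_of_form_neg {x : L n} (hx : form x x < 0) : modulus x = √(-form x x) := by
  rw [modulus, abs_of_neg hx]

lemma isOpen_form_neg : IsOpen {x : L n | form x x < 0} :=
  isOpen_lt (continuous_form.comp (continuous_id.prodMk continuous_id)) continuous_const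

lemma contDiffOn_coshDist {k : WithTop ℕ∞} (c : L n) :
    ContDiffOn ℝ k (coshDist c) {x | form x x < 0} := by
  have h1 : ContDiff ℝ k fun x : L n => form x x := by unfold form; fun_prop
  have h2 : ContDiff ℝ k fun x : L n => form x c := by unfold form; fun_prop
  have h3 : ContDiffOn ℝ k (fun x : L n => -form x c * (√(-form x x))⁻¹) {x | form x x < 0} := by
    refine h2.neg.contDiffOn.mul (ContDiffOn.inv (h1.neg.contDiffOn.sqrt fun x hx => ?_)
      fun x hx => ?_)
    · exact (neg_pos.2 hx).ne'
    · exact (Real.sqrt_pos.2 (neg_pos.2 hx)).ne'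
  exact h3.congr fun x hx => by rw [coshDist, modulus_of_form_neg hx]

lemma hasFDerivAt_inv_modulus {x : L n} (hx : form x x < 0) :
    HasFDerivAt (fun x : L n => (modulus x)⁻¹) (((modulus x)⁻¹ ^ 3) • formCLM x) x := by
  have hpos : 0 < √(-form x x) := Real.sqrt_pos.2 (neg_pos.2 hx)
  have h1 := ((hasFDerivAt_form_self x).neg.sqrt (neg_pos.2 hx).ne')
  have h2 := (hasDerivAt_inv hpos.ne').comp_hasFDerivAt x h1
  have h3 : (fun x : L n => (modulus x)⁻¹) =ᶠ[nhds x] fun x => (√(-form x x))⁻¹ := by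
    filter_upwards [isOpen_form_neg.mem_nhds hx] with y hy
    rw [modulus_of_form_neg hy]
  refine (h2.congr_of_eventuallyEq h3).congr_fderiv ?_
  ext v
  simp only [modulus_of_form_neg hx, smul_apply,
    neg_apply, formCLM_apply, smul_eq_mul,
    Pi.neg_apply]
  field_simp

lemma hasFDerivAt_coshDist {x : L n} (hx : form x x < 0) (c : L n) :
    HasFDerivAt (coshDist c) (formCLM
      (-((modulus x)⁻¹ • c + (form x c * (modulus x)⁻¹ ^ 3) • x))) x := by
  have h := (hasFDerivAt_form_left c x).neg.mul (hasFDerivAt_inv_modulus hx)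
  refine HasFDerivAt.congr_fderiv h ?_
  ext v
  simp only [add_apply, smul_apply,
    neg_apply, formCLM_apply, smul_eq_mul, form_neg_left, form_add_left,
    form_smul_left, Pi.neg_apply]
  ring

lemma isOpen_one_lt_coshDist (c : L n) : IsOpen {x : L n | form x x < 0 ∧ 1 < coshDist c x} :=
  ((contDiffOn_coshDist (k := 0) c).continuousOn.isOpen_inter_preimage isOpen_form_neg isOpen_Ioi)

/-- The derivatives of `f` are continuous on the open set `U`, so they serve as their own extensions
to the cone over the closure. -/
lemma isCkCone_of_contDiffOn {k : ℕ} {Ω U : Set (L n)} {f : L n → ℝ} (hU : IsOpen U)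
    (hf : ContDiffOn ℝ k f U) (hΩ : cone (closure Ω) ⊆ U) : IsCkCone k Ω f := by
  have hsub : cone Ω ⊆ cone (closure Ω) := fun x ⟨q, hq, h⟩ => ⟨q, subset_closure hq, h⟩
  refine ⟨hf.mono (hsub.trans hΩ), hf.continuousOn.mono hΩ, fun m hm =>
    ⟨iteratedFDeriv ℝ m f, ?_, fun _ _ => rfl⟩⟩
  refine ContinuousOn.mono ?_ hΩ
  exact (hf.continuousOn_iteratedFDerivWithin (by exact_mod_cast hm) hU.uniqueDiffOn).congr
    fun x hx => (iteratedFDerivWithin_of_isOpen m hU hx).symm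

lemma isCkClosure_comp_neg_form {k : ℕ} {Ω : Set (L n)} {F : ℝ → ℝ} {c : L n}
    (hF : ContDiffOn ℝ k F (Set.Ioi 1)) (hΩ : closure Ω ⊆ hyp n)
    (hc : ∀ q ∈ closure Ω, 1 < -form q c) : IsCkClosure k Ω fun q => F (-form q c) := by
  rw [IsCkClosure, radialExt_comp_neg_form]
  refine isCkCone_of_contDiffOn (isOpen_one_lt_coshDist c)
    (hF.comp ((contDiffOn_coshDist c).mono fun x hx => hx.1) fun x hx => hx.2) ?_
  rintro x ⟨q, hq, ρ, hρ, rfl⟩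
  have hqq := (hΩ hq).1
  have hform : form (ρ • q) (ρ • q) = -ρ ^ 2 := by
    rw [form_smul_left, form_smul_right, hqq]; ring
  have hneg : form (ρ • q) (ρ • q) < 0 := by rw [hform]; nlinarith
  refine ⟨hneg, ?_⟩
  have : coshDist c (ρ • q) = -form q c := by
    rw [coshDist, modulus_of_form_neg hneg, hform, neg_neg, Real.sqrt_sq hρ.le, form_smul_left]
    field_simp
  rw [this]
  exact hc q hq

section RadialCalculus

variable {F F₁ : ℝ → ℝ} {c : L n}

lemma grad_comp_neg_form (hF : ∀ s, 1 < s → HasDerivAt F (F₁ s) s) {x : L n}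
    (hx : form x x < 0) (hcx : 1 < coshDist c x) :
    grad (fun q => F (-form q c)) x
      = -(F₁ (coshDist c x) • ((modulus x)⁻¹ • c + (form x c * (modulus x)⁻¹ ^ 3) • x)) := by
  rw [grad, radialExt_comp_neg_form]
  refine lgrad_eq (((hF _ hcx).comp_hasFDerivAt x (hasFDerivAt_coshDist hx c)).congr_fderiv ?_)
  ext v
  simp only [smul_apply, formCLM_apply, smul_eq_mul, form_neg_left, form_smul_left]
  ring

lemma grad_comp_neg_form_of_mem_hyp (hF : ∀ s, 1 < s → HasDerivAt F (F₁ s) s) {q : L n}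
    (hq : q ∈ hyp n) (hc : 1 < -form q c) :
    grad (fun q => F (-form q c)) q = -(F₁ (-form q c) • (c + form q c • q)) := by
  have h := coshDist_of_mem_hyp hq c
  rw [grad_comp_neg_form hF (by rw [hq.1]; norm_num) (by rwa [h]), h, modulus_of_mem_hyp hq]
  simp

/-- Chain rule, together with the fact that `s = -⟨·, c⟩` has Hessian `s` times the metric. -/
lemma hess_comp_neg_form (hF : ∀ s, 1 < s → HasDerivAt F (F₁ s) s) {q v w : L n} {b : ℝ}
    (hq : q ∈ hyp n) (hc : 1 < -form q c) (hF₁ : HasDerivAt F₁ b (-form q c))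
    (hv : form v q = 0) (hw : form w q = 0) :
    hess (fun q => F (-form q c)) q v w
      = b * form c v * form c w + F₁ (-form q c) * (-form q c) * form v w := by
  have hqneg : form q q < 0 := by rw [hq.1]; norm_num
  have hcd := coshDist_of_mem_hyp hq c
  have hmod := modulus_of_mem_hyp hq
  have hk := hasFDerivAt_inv_modulus hqneg
  have hd := ((HasDerivAt.comp_hasFDerivAt q (by rwa [hcd]) (hasFDerivAt_coshDist hqneg c)).smul
    ((hk.smul_const c).add (((hasFDerivAt_form_left c q).mul (hk.pow 3)).smul
      (hasFDerivAt_id q)))).neg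
  have hev : grad (fun q => F (-form q c)) =ᶠ[nhds q] fun x =>
      -(F₁ (coshDist c x) • ((modulus x)⁻¹ • c + (form x c * (modulus x)⁻¹ ^ 3) • x)) := by
    filter_upwards [(isOpen_one_lt_coshDist c).mem_nhds ⟨hqneg, by rwa [hcd]⟩] with x hx
    exact grad_comp_neg_form hF hx.1 hx.2
  have hqv : form q v = 0 := by rw [form_comm, hv]
  have hqw : form q w = 0 := by rw [form_comm, hw]
  rw [hess, covDeriv, (hd.congr_of_eventuallyEq hev).fderiv]
  simp [tangProj, form_add_left, form_smul_left, form_neg_left, hmod, hcd, hqv, hqw,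
    hv, hq.1]
  ring

lemma form_tangential (q : L n) (hq : q ∈ hyp n) (hc : c ∈ hyp n) :
    form (c + form q c • q) (c + form q c • q) = form q c ^ 2 - 1 := by
  simp only [form_add_left, form_add_right, form_smul_left, form_smul_right, hq.1, hc.1,
    form_comm c q]
  ring

lemma modulus_grad_comp_neg_form (hF : ∀ s, 1 < s → HasDerivAt F (F₁ s) s) {q : L n}
    (hq : q ∈ hyp n) (hcm : c ∈ hyp n) (hc : 1 < -form q c) :
    modulus (grad (fun q => F (-form q c)) q)
      = |F₁ (-form q c)| * √((-form q c) ^ 2 - 1) := by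
  rw [grad_comp_neg_form_of_mem_hyp hF hq hc, modulus, ← neg_smul, form_smul_left,
    form_smul_right, form_tangential q hq hcm, ← mul_assoc, abs_mul, Real.sqrt_mul (abs_nonneg _),
    neg_mul_neg, ← pow_two, abs_pow, Real.sqrt_sq (abs_nonneg _), neg_sq,
    abs_of_nonneg (by nlinarith : 0 ≤ form q c ^ 2 - 1)]

/-- Here `a` stands for the frame components of the centre, and `p`, `b` for `F'`, `F''`. Both
matrices are a multiple of the identity plus a multiple of `a aᵀ`, so only `A` survives. -/
lemma sum_sum_radial {m : ℕ} (a : Fin m → ℝ) {A : ℝ} (hA : ∑ i, a i ^ 2 = A) (P p b s : ℝ) :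
    ∑ i, ∑ j, (P * (if i = j then 1 else 0) + -(p * a i) * -(p * a j))
        * (b * a i * a j + p * s * (if i = j then 1 else 0))
      = P * b * A + m * (P * p * s) + p ^ 2 * b * A ^ 2 + p ^ 3 * s * A := by
  have hinner : ∀ i, ∑ j, (P * (if i = j then 1 else 0) + -(p * a i) * -(p * a j))
        * (b * a i * a j + p * s * (if i = j then 1 else 0))
      = P * b * a i ^ 2 + P * p * s + p ^ 2 * b * A * a i ^ 2 + p ^ 3 * s * a i ^ 2 := fun i => by
    have : ∀ j, (P * (if i = j then 1 else 0) + -(p * a i) * -(p * a j))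
        * (b * a i * a j + p * s * (if i = j then 1 else 0))
      = (if i = j then P * b * a i * a j + P * p * s + p ^ 3 * s * a i * a j else 0)
        + p ^ 2 * b * a i ^ 2 * a j ^ 2 := fun j => by split_ifs <;> ring
    simp_rw [this]
    rw [Finset.sum_add_distrib, Finset.sum_ite_eq, ← Finset.mul_sum, hA]
    simp only [Finset.mem_univ, if_true]
    ring
  simp_rw [hinner]
  simp only [Finset.sum_add_distrib, ← Finset.mul_sum, hA, Finset.sum_const, Finset.card_univ,
    Fintype.card_fin, nsmul_eq_mul]
  ring

/-- The coefficient matrix has eigenvalue `1` in the radial direction and `P` across it. For `f(r) =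
F(cosh r)`, `b (s² - 1) + F₁ s * s` is `f''` and `F₁ s * s` is `f' coth r`. -/
lemma Qop_comp_neg_form (H : L n → ℝ) (t : ℝ) (hF : ∀ s, 1 < s → HasDerivAt F (F₁ s) s) {q : L n}
    {b s P : ℝ} (hq : q ∈ hyp n) (hcm : c ∈ hyp n) (hs : -form q c = s) (hs1 : 1 < s)
    (hF₁ : HasDerivAt F₁ b s) (hP : 1 - F₁ s ^ 2 * (s ^ 2 - 1) = P)
    {e : Fin n → L n} (he : IsOrthonormalFrame q e) :
    Qop H t (fun q => F (-form q c)) q e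
      = b * (s ^ 2 - 1) + F₁ s * s * (1 + (n - 1) * P) - n * t * P
        + n * t * P ^ (3 / 2 : ℝ) * (Real.exp (F s) * H (Real.exp (F s) • q)) := by
  subst hs
  have hmod : modulus (grad (fun q => F (-form q c)) q) ^ 2
      = F₁ (-form q c) ^ 2 * ((-form q c) ^ 2 - 1) := by
    rw [modulus_grad_comp_neg_form hF hq hcm hs1, mul_pow, sq_abs, Real.sq_sqrt (by nlinarith)]
  have hge : ∀ i, form (grad (fun q => F (-form q c)) q) (e i)
      = -(F₁ (-form q c) * form c (e i)) := fun i => by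
    rw [grad_comp_neg_form_of_mem_hyp hF hq hs1, form_neg_left, form_smul_left, form_add_left,
      form_smul_left, form_comm q (e i), he.1]
    ring
  have hA : ∑ i, form c (e i) ^ 2 = (-form q c) ^ 2 - 1 := by
    have hX : form (c + form q c • q) q = 0 := by
      rw [form_add_left, form_smul_left, hq.1, form_comm c q]; ring
    rw [neg_sq, ← form_tangential q hq hcm, ← he.sum_form_sq hq.1 hX]
    refine Finset.sum_congr rfl fun i _ => ?_
    rw [form_add_left, form_smul_left, form_comm q (e i), he.1, mul_zero, add_zero]
  have hh : ∀ i j, hess (fun q => F (-form q c)) q (e i) (e j)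
      = b * form c (e i) * form c (e j)
        + F₁ (-form q c) * (-form q c) * (if i = j then 1 else 0) := fun i j => by
    rw [hess_comp_neg_form hF hq hs1 hF₁ (he.1 i) (he.1 j), he.2]
  simp only [Qop, hmod, hge, hh, hP]
  rw [sum_sum_radial _ hA]
  subst hP
  ring

end RadialCalculus

/-! ### The barrier -/

lemma hasDerivAt_tanh (x : ℝ) : HasDerivAt Real.tanh (1 - Real.tanh x ^ 2) x := by
  have h : HasDerivAt (fun x => Real.sinh x / Real.cosh x) _ x :=
    (Real.hasDerivAt_sinh x).div (Real.hasDerivAt_cosh x) (Real.cosh_pos x).ne'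
  have hfun : Real.tanh = fun x => Real.sinh x / Real.cosh x :=
    funext Real.tanh_eq_sinh_div_cosh
  rw [hfun]
  refine h.congr_deriv ?_
  have := (Real.cosh_pos x).ne'
  field_simp

lemma monotone_tanh : Monotone Real.tanh :=
  monotone_of_hasDerivAt_nonneg hasDerivAt_tanh fun x => by
    have := Real.tanh_sq_lt_one x
    simp only [Pi.zero_apply]; linarith

/-- The slope, as a function of `s = cosh r`, of the radial barrier. -/
def barrierSlope (C R s : ℝ) : ℝ := Real.tanh (C * (R - Real.arcosh s))

/-- The radial barrier as a function of `s = cosh r`, where `r` is the distance to the centre: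
it vanishes at `r = σ` and its derivative with respect to `r` is `-tanh (C (R - r))`. -/
def barrier (C R σ s : ℝ) : ℝ :=
  (Real.log (Real.cosh (C * (R - Real.arcosh s))) - Real.log (Real.cosh (C * (R - σ)))) / C

section Barrier

variable {C R σ s : ℝ}

lemma hasDerivAt_barrier (hC : 0 < C) (hs : 1 < s) :
    HasDerivAt (barrier C R σ) (-barrierSlope C R s / √(s ^ 2 - 1)) s := by
  have hD : 0 < √(s ^ 2 - 1) := Real.sqrt_pos.2 (by nlinarith)
  have h := ((((Real.hasDerivAt_arcosh hs).const_sub R).const_mul C).cosh.log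
    (Real.cosh_pos _).ne').sub_const (Real.log (Real.cosh (C * (R - σ)))) |>.div_const C
  refine HasDerivAt.congr_deriv h ?_
  have := (Real.cosh_pos (C * (R - Real.arcosh s))).ne'
  rw [barrierSlope, Real.tanh_eq_sinh_div_cosh]
  field_simp

/-- The equation `tanh' = 1 - tanh²` is the reason for the choice of profile: the second derivative
carries the factor `1 - |∇u|²`. -/
lemma hasDerivAt_barrierSlope (hs : 1 < s) :
    HasDerivAt (barrierSlope C R) (-C * (1 - barrierSlope C R s ^ 2) / √(s ^ 2 - 1)) s := by
  have h := (hasDerivAt_tanh (C * (R - Real.arcosh s))).comp s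
    (((Real.hasDerivAt_arcosh hs).const_sub R).const_mul C)
  refine HasDerivAt.congr_deriv h ?_
  rw [barrierSlope]
  ring

lemma hasDerivAt_barrierSlope_div (hs : 1 < s) :
    HasDerivAt (fun s => -barrierSlope C R s / √(s ^ 2 - 1))
      ((C * (1 - barrierSlope C R s ^ 2) + barrierSlope C R s * s / √(s ^ 2 - 1))
        / (s ^ 2 - 1)) s := by
  have hD2 : 0 < s ^ 2 - 1 := by nlinarith
  have hD : 0 < √(s ^ 2 - 1) := Real.sqrt_pos.2 hD2
  have h := (hasDerivAt_barrierSlope (C := C) (R := R) hs).neg.div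
    (((hasDerivAt_pow 2 s).sub_const 1).sqrt hD2.ne') hD.ne'
  refine HasDerivAt.congr_deriv h ?_
  have hsq : s ^ 2 - 1 = √(s ^ 2 - 1) ^ 2 := (Real.sq_sqrt hD2.le).symm
  simp only [Pi.neg_apply]
  rw [show ((s ^ 2 - 1) : ℝ) = √(s ^ 2 - 1) ^ 2 from hsq, Real.sqrt_sq hD.le]
  generalize √(s ^ 2 - 1) = D at hD
  push_cast
  field_simp
  ring

lemma contDiffOn_barrier {k : WithTop ℕ∞} : ContDiffOn ℝ k (barrier C R σ) (Set.Ioi 1) := by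
  have h : ContDiffOn ℝ k (fun s => C * (R - Real.arcosh s)) (Set.Ioi 1) :=
    contDiffOn_const.mul (contDiffOn_const.sub Real.contDiffOn_arcosh)
  exact ((h.cosh.log fun s _ => (Real.cosh_pos _).ne').sub contDiffOn_const).div_const C

lemma barrier_cosh_self (hσ : 0 ≤ σ) : barrier C R σ (Real.cosh σ) = 0 := by
  simp [barrier, Real.arcosh_cosh hσ]

lemma barrier_nonpos (hC : 0 < C) (h1 : σ ≤ Real.arcosh s) (h2 : Real.arcosh s ≤ R) :
    barrier C R σ s ≤ 0 := by
  refine div_nonpos_of_nonpos_of_nonneg (sub_nonpos.2 (Real.log_le_log (Real.cosh_pos _) ?_)) hC.le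
  rw [Real.cosh_le_cosh, abs_of_nonneg (mul_nonneg hC.le (by linarith)),
    abs_of_nonneg (mul_nonneg hC.le (by linarith))]
  exact mul_le_mul_of_nonneg_left (by linarith) hC.le

lemma barrierSlope_nonneg (hC : 0 < C) (h2 : Real.arcosh s ≤ R) : 0 ≤ barrierSlope C R s := by
  rw [← Real.tanh_zero]
  exact monotone_tanh (mul_nonneg hC.le (by linarith))

lemma barrierSlope_le (hC : 0 < C) (h1 : σ ≤ Real.arcosh s) :
    barrierSlope C R s ≤ Real.tanh (C * (R - σ)) :=
  monotone_tanh (mul_le_mul_of_nonneg_left (by linarith) hC.le)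

/-- `coth` decreases, which after clearing denominators is `sinh (r - σ) ≥ 0`. -/
lemma div_sqrt_le_coth (hs : 1 < s) (hσ : 0 < σ) (h1 : σ ≤ Real.arcosh s) :
    s / √(s ^ 2 - 1) ≤ Real.cosh σ / Real.sinh σ := by
  have hD : 0 < √(s ^ 2 - 1) := Real.sqrt_pos.2 (by nlinarith)
  rw [div_le_div_iff₀ hD (Real.sinh_pos_iff.2 hσ)]
  have h := Real.sinh_sub (Real.arcosh s) σ
  rw [Real.cosh_arcosh hs.le, Real.sinh_arcosh hs.le] at h
  have := Real.sinh_nonneg_iff.2 (sub_nonneg.2 h1)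
  linarith

end Barrier

/-! ### Monotonicity along rays -/

/-- The function `s ↦ s H(s q)` is nonincreasing; compare its values at `1` and at `e^a ≥ 1`. -/
lemma exp_mul_le_of_deriv_nonpos {Ω : Set (L n)} {H : L n → ℝ} (hH : IsCkCone 1 Ω H) {q : L n}
    (hq : q ∈ Ω) (hmono : ∀ l : ℝ, 0 < l → deriv (fun s : ℝ => s * H (s • q)) l ≤ 0)
    {a : ℝ} (ha : 0 ≤ a) : Real.exp a * H (Real.exp a • q) ≤ H q := by
  have hd : DifferentiableOn ℝ (fun s : ℝ => s * H (s • q)) (Set.Ioi 0) := by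
    refine differentiableOn_id.mul ((hH.1.differentiableOn (by norm_num)).comp
      (f := fun s : ℝ => s • q) (by fun_prop) fun s hs => ⟨q, hq, s, hs, rfl⟩)
  have hanti : AntitoneOn (fun s : ℝ => s * H (s • q)) (Set.Ioi 0) := by
    refine antitoneOn_of_deriv_nonpos (convex_Ioi 0) hd.continuousOn ?_ ?_
    · rw [interior_Ioi]; exact hd
    · rw [interior_Ioi]; exact hmono
  simpa using hanti (Set.mem_Ioi.2 one_pos) (Set.mem_Ioi.2 (Real.exp_pos a)) (Real.one_le_exp ha)

/-! ### Uniform bounds -/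

lemma hfrontier_subset_closure (Ω : Set (L n)) : hfrontier Ω ⊆ closure Ω := fun _ h => h.1

lemma isClosed_hfrontier (Ω : Set (L n)) : IsClosed (hfrontier Ω) :=
  isClosed_closure.inter isClosed_closure

lemma IsCkOnSet.continuousOn {k : ℕ} {S : Set (L n)} {f : L n → L n} (h : IsCkOnSet k S f) :
    ContinuousOn f S := by
  intro x hx
  obtain ⟨U, hU, hxU, g, hg, hfg⟩ := h x hx
  have hgx : ContinuousWithinAt g (S ∩ U) x :=
    (hg.continuousOn.continuousAt (hU.mem_nhds hxU)).continuousWithinAt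
  have := hgx.congr (fun y hy => hfg hy) (hfg ⟨hx, hxU⟩)
  exact (continuousWithinAt_inter (hU.mem_nhds hxU)).1 this

lemma IsBoundedDomain.exists_hdist_le {Ω : Set (L n)} (hΩ : IsBoundedDomain Ω) {Ξ : L n → L n}
    (hΞ : ContinuousOn Ξ (hfrontier Ω)) (hm : ∀ q₀ ∈ hfrontier Ω, Ξ q₀ ∈ hyp n) :
    ∃ R : ℝ, ∀ q ∈ closure Ω, ∀ q₀ ∈ hfrontier Ω, hdist q (Ξ q₀) ≤ R := by
  have hK : IsCompact (closure Ω ×ˢ hfrontier Ω) := hΩ.isCompact_closure.prod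
    (hΩ.isCompact_closure.of_isClosed_subset (isClosed_hfrontier Ω) (hfrontier_subset_closure Ω))
  have hc : ContinuousOn (fun p : L n × L n => hdist p.1 (Ξ p.2)) (closure Ω ×ˢ hfrontier Ω) :=
    ContinuousOn.comp (g := fun p : L n × L n => hdist p.1 p.2)
      (f := fun p : L n × L n => (p.1, Ξ p.2)) continuousOn_hdist
      (continuousOn_fst.prodMk (hΞ.comp continuousOn_snd fun p hp => hp.2))
      fun p hp => Set.mk_mem_prod (hΩ.closure_subset hp.1) (hm _ hp.2)
  obtain ⟨R, hR⟩ := hK.bddAbove_image hc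
  exact ⟨R, fun q hq q₀ hq₀ => hR ⟨(q, q₀), ⟨hq, hq₀⟩, rfl⟩⟩

lemma IsBoundedDomain.exists_le_of_isCkCone {k : ℕ} {Ω : Set (L n)} (hΩ : IsBoundedDomain Ω)
    {H : L n → ℝ} (hH : IsCkCone k Ω H) : ∃ M : ℝ, ∀ q ∈ closure Ω, H q ≤ M := by
  obtain ⟨M, hM⟩ := hΩ.isCompact_closure.bddAbove_image
    (hH.2.1.mono fun q hq => ⟨q, hq, 1, one_pos, (one_smul ℝ q).symm⟩)
  exact ⟨M, fun q hq => hM ⟨q, hq, rfl⟩⟩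

end LorentzMinkowski

end

open LorentzMinkowski in
theorem proposition4p7 (n : ℕ) (hn : 2 ≤ n) (Ω : Set (L n)) (hΩ : IsBoundedDomain Ω)
    (hext : UniformExteriorBall Ω) (H : L n → ℝ) (hH : IsCkCone 1 Ω H)
    (hpos : ∀ x ∈ cone (closure Ω), 0 < H x)
    (hmono : ∀ q ∈ closure Ω, ∀ l : ℝ, 0 < l → deriv (fun s : ℝ => s * H (s • q)) l ≤ 0) :
    IsAdmissible Ω H := by
  obtain ⟨σ, hσ, Ξ, hΞ, hball⟩ := hext
  obtain ⟨R₀, hR₀⟩ := hΩ.exists_hdist_le hΞ.continuousOn fun q₀ hq₀ => (hball q₀ hq₀).1.1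
  obtain ⟨M₀, hM₀⟩ := hΩ.exists_le_of_isCkCone hH
  -- `R > σ` makes `tanh (C (R - σ))` positive, hence `θ < 1`; `M ≥ 1` will dominate `t`.
  set R := max R₀ (σ + 1)
  set M := max M₀ 1
  have hn1 : (1 : ℝ) ≤ n := by exact_mod_cast (by omega : 1 ≤ n)
  have hM1 : 1 ≤ M := le_max_right _ _
  set K := Real.cosh σ / Real.sinh σ
  have hK : 0 < K := div_pos (Real.cosh_pos σ) (Real.sinh_pos_iff.2 hσ)
  -- `(n - 1) K` beats the curvature term of the geodesic spheres, and `n M` remains for the terms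
  -- of order zero.
  set C := (n - 1) * K + n * M with hCdef
  have hC : 0 < C := by
    have : 0 ≤ ((n : ℝ) - 1) * K := mul_nonneg (by linarith) hK.le
    have : 0 < (n : ℝ) * M := by positivity
    linarith
  have hRσ : 0 < C * (R - σ) := mul_pos hC (by linarith [le_max_right R₀ (σ + 1)])
  have hT1 := Real.tanh_lt_one (C * (R - σ))
  have hT0 : 0 < Real.tanh (C * (R - σ)) := by
    rw [Real.tanh_eq_sinh_div_cosh]
    exact div_pos (Real.sinh_pos_iff.2 hRσ) (Real.cosh_pos _)
  refine ⟨1 - Real.tanh (C * (R - σ)), ⟨by linarith, by linarith⟩, fun q₀ hq₀ t ht => ?_⟩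
  obtain ⟨⟨hcm, -⟩, hq₀ball, hdisj⟩ := hball q₀ hq₀
  set c := Ξ q₀
  have hcl := hΩ.closure_subset
  have hlow : ∀ q ∈ closure Ω, σ ≤ Real.arcosh (-form q c) := fun q hq =>
    not_lt.1 fun h => (hdisj ⟨hcl hq, h⟩).2 hq
  have hup : ∀ q ∈ closure Ω, Real.arcosh (-form q c) ≤ R := fun q hq =>
    (hR₀ q hq q₀ hq₀).trans (le_max_left _ _)
  -- The radial functions are differentiated only away from the centre, where `s = 1` would give
  -- distance `0 < σ`.
  have hone : ∀ q ∈ closure Ω, 1 < -form q c := fun q hq => by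
    have h1 := one_le_neg_form (hcl hq) hcm
    refine lt_of_le_of_ne h1 fun h => ?_
    have := hlow q hq
    rw [← h, Real.arcosh_zero] at this
    linarith
  have hq₀c : -form q₀ c = Real.cosh σ := by
    rw [neg_form_eq_cosh (hcl hq₀.1) hcm, hdist_eq_of_mem_hfrontier_hball hcm hq₀ball]
  set F := barrier C R σ
  set F₁ : ℝ → ℝ := fun s => -barrierSlope C R s / √(s ^ 2 - 1) with hF₁def
  have hF : ∀ s, 1 < s → HasDerivAt F (F₁ s) s := fun s hs => hasDerivAt_barrier hC hs
  have hF' : ∀ s, 1 < s → HasDerivAt (fun s => -F s) (-F₁ s) s := fun s hs => (hF s hs).neg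
  have hCF : ContDiffOn ℝ 2 F (Set.Ioi 1) := contDiffOn_barrier
  have hslope : ∀ q ∈ closure Ω, |F₁ (-form q c)| * √((-form q c) ^ 2 - 1)
      ≤ 1 - (1 - Real.tanh (C * (R - σ))) := fun q hq => by
    have hs := hone q hq
    have hD : 0 < √((-form q c) ^ 2 - 1) := Real.sqrt_pos.2 (by nlinarith)
    rw [hF₁def, abs_div, abs_neg, abs_of_pos hD, div_mul_cancel₀ _ hD.ne',
      abs_of_nonneg (barrierSlope_nonneg hC (hup q hq)), sub_sub_cancel]
    exact barrierSlope_le hC (hlow q hq)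
  -- `P` is `1 - |∇u|²`, `b` is `F''` and `B` the second-order part of the operator at `φ₁`. Passing
  -- to `φ₂` keeps `P` and changes the signs of `b` and `B`, so one estimate serves both barriers.
  have key : ∀ q ∈ Ω, ∃ P B b : ℝ, 0 ≤ P ∧ P ≤ 1 ∧ P * (n * M) ≤ B ∧
      1 - F₁ (-form q c) ^ 2 * ((-form q c) ^ 2 - 1) = P ∧
      HasDerivAt F₁ b (-form q c) ∧
      b * ((-form q c) ^ 2 - 1) + F₁ (-form q c) * (-form q c) * (1 + (n - 1) * P) = B := by
    intro q hq
    have hqc := subset_closure hq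
    have hs := hone q hqc
    have hcoth := div_sqrt_le_coth hs hσ (hlow q hqc)
    have hg0 := barrierSlope_nonneg hC (hup q hqc)
    have hg1 : barrierSlope C R (-form q c) < 1 := Real.tanh_lt_one _
    have hD2 : 0 < (-form q c) ^ 2 - 1 := by nlinarith
    refine ⟨1 - barrierSlope C R (-form q c) ^ 2, _, _, by nlinarith, by nlinarith, ?_, ?_,
      hasDerivAt_barrierSlope_div hs, rfl⟩
    · rw [div_mul_cancel₀ _ hD2.ne']
      simp only [hF₁def]
      generalize -form q c = s at *
      have hD : 0 < √(s ^ 2 - 1) := Real.sqrt_pos.2 hD2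
      -- The slope lies in `[0, 1)` and `coth r ≤ coth σ = K`.
      have hgc : barrierSlope C R s * (s / √(s ^ 2 - 1)) ≤ K := by
        have : 0 ≤ s / √(s ^ 2 - 1) := div_nonneg (by linarith) hD.le
        nlinarith
      set g := barrierSlope C R s
      have h0 : 0 ≤ 1 - g ^ 2 := by nlinarith
      have h1 : (1 - g ^ 2) * (((n : ℝ) - 1) * (g * (s / √(s ^ 2 - 1))))
          ≤ (1 - g ^ 2) * ((n - 1) * K) :=
        mul_le_mul_of_nonneg_left (mul_le_mul_of_nonneg_left hgc (by linarith)) h0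
      have h2 : C * (1 - g ^ 2) + g * s / √(s ^ 2 - 1)
          + -g / √(s ^ 2 - 1) * s * (1 + (n - 1) * (1 - g ^ 2))
          = (1 - g ^ 2) * C - (1 - g ^ 2) * ((n - 1) * (g * (s / √(s ^ 2 - 1)))) := by ring
      rw [h2, hCdef]
      linarith
    · rw [hF₁def, div_pow, Real.sq_sqrt hD2.le, div_mul_cancel₀ _ hD2.ne', neg_sq]
  refine ⟨fun q => F (-form q c), fun q => -F (-form q c),
    isCkClosure_comp_neg_form hCF hcl hone,
    isCkClosure_comp_neg_form (F := fun s => -F s) hCF.neg hcl hone,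
    fun q hq => ?_, fun q hq => ?_,
    ⟨by simp only [hq₀c]; exact barrier_cosh_self hσ.le,
      fun q hq => barrier_nonpos hC (hlow q hq.1) (hup q hq.1)⟩,
    ⟨by simp only [hq₀c, neg_eq_zero]; exact barrier_cosh_self hσ.le,
      fun q hq => neg_nonneg.2 (barrier_nonpos hC (hlow q hq.1) (hup q hq.1))⟩,
    fun q hq e he => ?_, fun q hq e he => ?_⟩
  · have hqc := subset_closure hq
    rw [modulus_grad_comp_neg_form hF (hcl hqc) hcm (hone q hqc)]
    exact hslope q hqc
  · have hqc := subset_closure hq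
    rw [modulus_grad_comp_neg_form (F := fun s => -F s) hF' (hcl hqc) hcm (hone q hqc), abs_neg]
    exact hslope q hqc
  · have hqc := subset_closure hq
    obtain ⟨P, B, b, hP0, hP1, hB, hP, hb, hBeq⟩ := key q hq
    rw [Qop_comp_neg_form H t hF (hcl hqc) hcm rfl (hone q hqc) hb hP he, hBeq]
    have hHpos := hpos (Real.exp (F (-form q c)) • q) ⟨q, hqc, _, Real.exp_pos _, rfl⟩
    have h1 : 0 ≤ n * t * P ^ (3 / 2 : ℝ)
        * (Real.exp (F (-form q c)) * H (Real.exp (F (-form q c)) • q)) := by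
      have := ht.1
      positivity
    have h2 : n * t * P ≤ P * (n * M) := by
      have : t ≤ M := ht.2.trans hM1
      nlinarith [mul_nonneg (Nat.cast_nonneg (α := ℝ) n) hP0]
    linarith
  · have hqc := subset_closure hq
    obtain ⟨P, B, b, hP0, hP1, hB, hP, hb, hBeq⟩ := key q hq
    rw [Qop_comp_neg_form (F := fun s => -F s) (P := P) H t hF' (hcl hqc) hcm rfl (hone q hqc) hb.neg
      (by rwa [neg_sq]) he]
    -- The sign of `φ₂` puts `e^u q` at or beyond `q` on its ray, where monotonicity bounds the term
    -- with `H` by its value at `q`.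
    have hFn : 0 ≤ -F (-form q c) :=
      neg_nonneg.2 (barrier_nonpos hC (hlow q hqc) (hup q hqc))
    have hHle : Real.exp (-F (-form q c)) * H (Real.exp (-F (-form q c)) • q) ≤ M :=
      ((exp_mul_le_of_deriv_nonpos hH hq (hmono q hqc) hFn).trans (hM₀ q hqc)).trans
        (le_max_left _ _)
    have hPP : P ^ (3 / 2 : ℝ) ≤ P := by
      simpa using Real.rpow_le_rpow_of_exponent_ge' hP0 hP1 zero_le_one
        (by norm_num : (1 : ℝ) ≤ 3 / 2)
    have h1 : n * t * P ^ (3 / 2 : ℝ)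
        * (Real.exp (-F (-form q c)) * H (Real.exp (-F (-form q c)) • q)) ≤ n * 1 * P * M := by
      have := ht.1
      have := ht.2
      refine (mul_le_mul_of_nonneg_left hHle (by positivity)).trans ?_
      gcongr
    have h2 : 0 ≤ n * t * P := by
      have := ht.1
      positivity
    linarith
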